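/- Let $?:[0,1]\to[0,1]$ be the Minkowski question mark function, $$?([0;a_1,a_2,a_3,\ldots])=2\sum_{i\ge1}(-1)^{i+1}2^{-(a_1+\cdots+a_i)},$$ where $[0;a_1,a_2,\ldots]$ is the regular continued fraction expansion of $x$ (a finite sum for rational $x$; $?(0)=0$, $?(1)=1$). It is continuous and increasing; let $\mathrm{d}?(x)$ be its Stieltjes probability measure on $[0,1]$. Put $$m_L=\int_0^1x^L\,\mathrm{d}?(x),\qquad \mathfrak m(t)=\int_0^1e^{xt}\,\mathrm{d}?(x),\qquad d_n=\mathfrak m(2\pi i n),\qquad \mathfrak M(s)=\sum_{n=1}^\infty\frac{d_n}{n^s},$$ where the last sum is the limit of the partial sums $\sum_{n=1}^N d_n/n^s$ as $N\to\infty$, wherever this limit exists. **Proposition.** The series $\mathfrak M(1)=\sum_{n\ge1}d_n/n$ converges, and $$\mathfrak M(1)=\sum_{n=1}^\infty\frac{(\zeta(2n)-1)\,m_{2n}}{n}-3\sum_{n=1}^\infty\frac{m_n}{n\,2^n}-\log\pi+\log4 .$$ Both series on the right converge absolutely and fast: their $n$-th terms are $O(4^{-n})$ and $O(2^{-n})$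 respectively. -/

import Mathlib

open MeasureTheory Filter Topology

namespace Minkowski

/-! ### The Minkowski question mark function -/

/-- The partial quotient `a_i` of the regular continued fraction `x = [a₀; a₁, a₂, …]`, as computed
by Mathlib's `GenContFract.IntFractPair.stream` (so that `a₀ = ⌊x⌋`). It takes the dummy
value `0` once a finite expansion has stopped. -/
noncomputable def quot (x : ℝ) (i : ℕ) : ℤ :=
  (GenContFract.IntFractPair.stream x i).elim 0 (fun p => p.b)

/-- The term `(-1)^i 2^{-(a₁ + ⋯ + a_{i+1})}`, or `0` if the partial quotient `a_{i+1}`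
does not exist. -/
noncomputable def qmTerm (x : ℝ) (i : ℕ) : ℝ :=
  if (GenContFract.IntFractPair.stream x (i + 1)).isSome then
    (-1) ^ i * (2 : ℝ) ^ (-∑ j ∈ Finset.range (i + 1), quot x (j + 1))
  else 0

/-- The question mark function
`?([a₀; a₁, a₂, …]) = a₀ + 2 ∑_{i ≥ 1} (-1)^{i+1} 2^{-(a₁ + ⋯ + a_i)}`.
Only its values on `[0, 1]` are used: `a₀ = 0` on `[0, 1)`, and `?(1) = 1`. -/
noncomputable def questionMark (x : ℝ) : ℝ :=
  ⌊x⌋ + 2 * ∑' i : ℕ, qmTerm x i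

/-! ### Monotonicity and continuity, needed to speak of the Stieltjes measure -/

theorem stream_of_fract_eq_zero {x : ℝ} (h : Int.fract x = 0) (i : ℕ) :
    GenContFract.IntFractPair.stream x (i + 1) = none := by
  have hx : x = (⌊x⌋ : ℝ) := by
    have := Int.floor_add_fract x
    rw [h] at this
    linarith
  rw [hx]
  exact GenContFract.IntFractPair.stream_succ_of_int _ _

theorem qmTerm_of_fract_eq_zero {x : ℝ} (h : Int.fract x = 0) (i : ℕ) : qmTerm x i = 0 := by
  simp [qmTerm, stream_of_fract_eq_zero h]

theorem quot_succ {x : ℝ} (h : Int.fract x ≠ 0) (i : ℕ) :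
    quot x (i + 1) = quot (Int.fract x)⁻¹ i := by
  simp [quot, GenContFract.IntFractPair.stream_succ h]

theorem quot_zero (x : ℝ) : quot x 0 = ⌊x⌋ := by
  rw [quot, GenContFract.IntFractPair.stream_zero]
  rfl

theorem qmTerm_zero {x : ℝ} (h : Int.fract x ≠ 0) :
    qmTerm x 0 = (2 : ℝ) ^ (-⌊(Int.fract x)⁻¹⌋) := by
  simp [qmTerm, quot_succ h, quot_zero, GenContFract.IntFractPair.stream_succ h,
    GenContFract.IntFractPair.stream_zero]

theorem qmTerm_succ {x : ℝ} (h : Int.fract x ≠ 0) (i : ℕ) :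
    qmTerm x (i + 1) = -(2 : ℝ) ^ (-⌊(Int.fract x)⁻¹⌋) * qmTerm (Int.fract x)⁻¹ i := by
  have hs : ∑ j ∈ Finset.range (i + 1 + 1), quot x (j + 1)
      = ⌊(Int.fract x)⁻¹⌋ + ∑ j ∈ Finset.range (i + 1), quot (Int.fract x)⁻¹ (j + 1) := by
    rw [Finset.sum_range_succ', add_comm]
    simp only [quot_succ h, quot_zero]
  unfold qmTerm
  rw [GenContFract.IntFractPair.stream_succ h, hs, neg_add,
    zpow_add₀ (by norm_num : (2 : ℝ) ≠ 0), pow_succ]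
  split_ifs <;> ring

theorem qmTerm_fract (x : ℝ) (i : ℕ) : qmTerm (Int.fract x) i = qmTerm x i := by
  by_cases h : Int.fract x = 0
  · rw [qmTerm_of_fract_eq_zero h, qmTerm_of_fract_eq_zero (by rw [Int.fract_fract, h])]
  · have h' : Int.fract (Int.fract x) ≠ 0 := by rwa [Int.fract_fract]
    cases i with
    | zero => rw [qmTerm_zero h, qmTerm_zero h', Int.fract_fract]
    | succ i => rw [qmTerm_succ h, qmTerm_succ h', Int.fract_fract]

theorem one_le_floor_inv {x : ℝ} (h0 : 0 < x) (h1 : x ≤ 1) : 1 ≤ ⌊x⁻¹⌋ := by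
  rw [Int.le_floor]
  simpa using (one_le_inv₀ h0).2 h1

theorem two_zpow_neg_le {k : ℤ} (h : 1 ≤ k) : (2 : ℝ) ^ (-k) ≤ 1 / 2 := by
  calc (2 : ℝ) ^ (-k) ≤ 2 ^ (-1 : ℤ) := zpow_le_zpow_right₀ (by norm_num) (by omega)
    _ = 1 / 2 := by norm_num

theorem one_le_floor_inv_fract {x : ℝ} (h : Int.fract x ≠ 0) : 1 ≤ ⌊(Int.fract x)⁻¹⌋ :=
  one_le_floor_inv (lt_of_le_of_ne (Int.fract_nonneg x) (Ne.symm h)) (Int.fract_lt_one x).le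

theorem abs_qmTerm_le (i : ℕ) : ∀ x : ℝ, |qmTerm x i| ≤ (1 / 2) ^ (i + 1) := by
  induction i with
  | zero =>
    intro x
    by_cases h : Int.fract x = 0
    · rw [qmTerm_of_fract_eq_zero h]; norm_num
    · rw [qmTerm_zero h, abs_of_nonneg (by positivity)]
      simpa using two_zpow_neg_le (one_le_floor_inv_fract h)
  | succ i ih =>
    intro x
    by_cases h : Int.fract x = 0
    · rw [qmTerm_of_fract_eq_zero h, abs_zero]; positivity
    · rw [qmTerm_succ h, abs_mul, abs_neg, abs_of_nonneg (by positivity), pow_succ' _ (i + 1)]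
      exact mul_le_mul (two_zpow_neg_le (one_le_floor_inv_fract h)) (ih _) (abs_nonneg _)
        (by norm_num)

theorem summable_half : Summable (fun i : ℕ => ((1 : ℝ) / 2) ^ (i + 1)) :=
  (summable_nat_add_iff 1).2 summable_geometric_two

theorem summable_abs_qmTerm (x : ℝ) : Summable (fun i => |qmTerm x i|) :=
  Summable.of_nonneg_of_le (fun _ => abs_nonneg _) (fun i => abs_qmTerm_le i x) summable_half

theorem summable_qmTerm (x : ℝ) : Summable (qmTerm x) := (summable_abs_qmTerm x).of_abs

theorem abs_tsum_qmTerm_le (x : ℝ) : |∑' i, qmTerm x i| ≤ 1 := by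
  have h1 : |∑' i, qmTerm x i| ≤ ∑' i, |qmTerm x i| := by
    simpa [Real.norm_eq_abs] using
      norm_tsum_le_tsum_norm (f := qmTerm x) (by simpa using summable_abs_qmTerm x)
  have h2 : ∑' i, |qmTerm x i| ≤ ∑' i : ℕ, ((1 : ℝ) / 2) ^ (i + 1) :=
    (summable_abs_qmTerm x).tsum_le_tsum (fun i => abs_qmTerm_le i x) summable_half
  have h3 : ∑' i : ℕ, ((1 : ℝ) / 2) ^ (i + 1) = 1 := by
    simp only [pow_succ, tsum_mul_right, tsum_geometric_two]
    norm_num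
  linarith

theorem questionMark_eq_floor_add (x : ℝ) :
    questionMark x = ⌊x⌋ + questionMark (Int.fract x) := by
  simp [questionMark, qmTerm_fract]

theorem questionMark_intCast (k : ℤ) : questionMark k = k := by
  simp [questionMark, qmTerm_of_fract_eq_zero]

theorem questionMark_zero : questionMark 0 = 0 := by
  simpa using questionMark_intCast 0

theorem questionMark_one : questionMark 1 = 1 := by
  simpa using questionMark_intCast 1

/-- The recursion `?(x) = 2^{-a₁} (2 - ?(1/x - a₁))`, where `a₁ = ⌊1/x⌋`. -/
theorem questionMark_rec {x : ℝ} (h0 : 0 < x) (h1 : x ≤ 1) :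
    questionMark x = (2 : ℝ) ^ (-⌊x⁻¹⌋) * (2 - questionMark (Int.fract x⁻¹)) := by
  rcases h1.eq_or_lt with rfl | h1
  · rw [questionMark_one]
    simp [questionMark_zero]
  · have hf : Int.fract x = x := Int.fract_eq_self.2 ⟨h0.le, h1⟩
    have hne : Int.fract x ≠ 0 := by rw [hf]; exact h0.ne'
    have hfl : ⌊x⌋ = 0 := Int.floor_eq_zero_iff.2 ⟨h0.le, h1⟩
    have hsum : ∑' i, qmTerm x i
        = (2 : ℝ) ^ (-⌊x⁻¹⌋) - (2 : ℝ) ^ (-⌊x⁻¹⌋) * ∑' i, qmTerm x⁻¹ i := by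
      rw [(summable_qmTerm x).tsum_eq_zero_add, qmTerm_zero hne]
      simp only [qmTerm_succ hne, tsum_mul_left, hf]
      ring
    simp only [questionMark, qmTerm_fract, hsum, hfl, Int.floor_fract]
    push_cast
    ring

theorem questionMark_bound (n : ℕ) : ∀ x : ℝ, 0 ≤ x → x ≤ 1 →
    -(2 * (1 / 2) ^ n) ≤ questionMark x ∧ questionMark x ≤ 1 + 2 * (1 / 2) ^ n := by
  induction n with
  | zero =>
    intro x h0 h1
    rcases h1.eq_or_lt with rfl | h1
    · rw [questionMark_one]; norm_num
    · have hfl : ⌊x⌋ = 0 := Int.floor_eq_zero_iff.2 ⟨h0, h1⟩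
      have := abs_le.1 (abs_tsum_qmTerm_le x)
      simp only [questionMark, hfl]
      push_cast
      constructor <;> linarith
  | succ n ih =>
    intro x h0 h1
    have hc : (0 : ℝ) < (1 / 2) ^ n := by positivity
    rcases h0.eq_or_lt with rfl | h0
    · rw [questionMark_zero]
      constructor <;> [skip; skip] <;> nlinarith [pow_succ (1 / 2 : ℝ) n]
    · obtain ⟨l, u⟩ := ih (Int.fract x⁻¹) (Int.fract_nonneg _) (Int.fract_lt_one _).le
      have hp : (0 : ℝ) < (2 : ℝ) ^ (-⌊x⁻¹⌋) := by positivity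
      have hp' := two_zpow_neg_le (one_le_floor_inv h0 h1)
      rw [questionMark_rec h0 h1, pow_succ]
      constructor <;> nlinarith

theorem questionMark_mem {x : ℝ} (h0 : 0 ≤ x) (h1 : x ≤ 1) :
    0 ≤ questionMark x ∧ questionMark x ≤ 1 := by
  have ht : Tendsto (fun n : ℕ => 2 * ((1 : ℝ) / 2) ^ n) atTop (𝓝 0) := by
    simpa using (tendsto_pow_atTop_nhds_zero_of_lt_one (r := (1 / 2 : ℝ)) (by norm_num)
      (by norm_num)).const_mul 2
  constructor
  · exact le_of_tendsto (by simpa using ht.neg)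
      (Eventually.of_forall fun n => (questionMark_bound n x h0 h1).1)
  · exact ge_of_tendsto (by simpa using ht.const_add 1)
      (Eventually.of_forall fun n => (questionMark_bound n x h0 h1).2)

theorem questionMark_mono_aux (n : ℕ) : ∀ x y : ℝ, 0 ≤ x → x ≤ y → y ≤ 1 →
    questionMark x - questionMark y ≤ (1 / 2) ^ n := by
  induction n with
  | zero =>
    intro x y h0 hxy h1
    have := questionMark_mem h0 (hxy.trans h1)
    have := questionMark_mem (h0.trans hxy) h1
    norm_num
    linarith
  | succ n ih =>
    intro x y h0 hxy h1
    have hc : (0 : ℝ) < (1 / 2) ^ (n + 1) := by positivity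
    rcases h0.eq_or_lt with rfl | h0
    · rw [questionMark_zero]
      linarith [questionMark_mem hxy h1]
    · have hy0 : 0 < y := h0.trans_le hxy
      have hinv : y⁻¹ ≤ x⁻¹ := inv_anti₀ h0 hxy
      have hx := questionMark_rec h0 (hxy.trans h1)
      have hy := questionMark_rec hy0 h1
      have bx := questionMark_mem (Int.fract_nonneg x⁻¹) (Int.fract_lt_one x⁻¹).le
      have b_y := questionMark_mem (Int.fract_nonneg y⁻¹) (Int.fract_lt_one y⁻¹).le
      have px : (0 : ℝ) < (2 : ℝ) ^ (-⌊x⁻¹⌋) := by positivity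
      have py : (0 : ℝ) < (2 : ℝ) ^ (-⌊y⁻¹⌋) := by positivity
      rcases (Int.floor_le_floor hinv).eq_or_lt with he | hlt
      · have hfr : Int.fract y⁻¹ ≤ Int.fract x⁻¹ := by
          unfold Int.fract
          rw [he]
          linarith
        have := ih _ _ (Int.fract_nonneg y⁻¹) hfr (Int.fract_lt_one x⁻¹).le
        have p2 := two_zpow_neg_le (one_le_floor_inv h0 (hxy.trans h1))
        rw [hx, hy, he, pow_succ]
        have hc' : (0 : ℝ) < (1 / 2) ^ n := by positivity
        nlinarith
      · have hle : 2 * (2 : ℝ) ^ (-⌊x⁻¹⌋) ≤ (2 : ℝ) ^ (-⌊y⁻¹⌋) := by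
          have : 2 * (2 : ℝ) ^ (-⌊x⁻¹⌋) = (2 : ℝ) ^ (-⌊x⁻¹⌋ + 1) := by
            rw [zpow_add_one₀ (by norm_num)]; ring
          rw [this]
          exact zpow_le_zpow_right₀ (by norm_num) (by omega)
        rw [hx, hy]
        nlinarith

theorem questionMark_le_of_le {x y : ℝ} (h0 : 0 ≤ x) (hxy : x ≤ y) (h1 : y ≤ 1) :
    questionMark x ≤ questionMark y := by
  have ht : Tendsto (fun n : ℕ => ((1 : ℝ) / 2) ^ n) atTop (𝓝 0) :=
    tendsto_pow_atTop_nhds_zero_of_lt_one (by norm_num) (by norm_num)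
  have := ge_of_tendsto ht (Eventually.of_forall fun n => questionMark_mono_aux n x y h0 hxy h1)
  linarith

theorem questionMark_monotone : Monotone questionMark := by
  intro x y hxy
  rw [questionMark_eq_floor_add x, questionMark_eq_floor_add y]
  rcases (Int.floor_le_floor hxy).eq_or_lt with he | hlt
  · have hfr : Int.fract x ≤ Int.fract y := by
      unfold Int.fract
      rw [he]
      linarith
    have := questionMark_le_of_le (Int.fract_nonneg x) hfr (Int.fract_lt_one y).le
    rw [he]
    linarith
  · have h1 : (⌊x⌋ : ℝ) + 1 ≤ ⌊y⌋ := by exact_mod_cast hlt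
    have h2 := questionMark_mem (Int.fract_nonneg x) (Int.fract_lt_one x).le
    have h3 := questionMark_mem (Int.fract_nonneg y) (Int.fract_lt_one y).le
    linarith

theorem questionMark_inv_one_add {x : ℝ} (h0 : 0 ≤ x) (h1 : x ≤ 1) :
    questionMark (1 + x)⁻¹ = 1 - questionMark x / 2 := by
  have hp : 0 < 1 + x := by linarith
  rw [questionMark_rec (inv_pos.2 hp) (inv_le_one_of_one_le₀ (by linarith)), inv_inv]
  rcases h1.eq_or_lt with rfl | h1
  · have h2 : (1 + 1 : ℝ) = ((2 : ℤ) : ℝ) := by norm_num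
    rw [h2, Int.floor_intCast, Int.fract_intCast, questionMark_zero, questionMark_one]
    norm_num
  · have hfl : ⌊x⌋ = 0 := Int.floor_eq_zero_iff.2 ⟨h0, h1⟩
    have hfr : Int.fract x = x := Int.fract_eq_self.2 ⟨h0, h1⟩
    rw [show (1 : ℝ) + x = x + 1 by ring, Int.floor_add_one, Int.fract_add_one, hfl, hfr]
    norm_num
    ring

theorem questionMark_div_one_add {x : ℝ} (h0 : 0 ≤ x) (h1 : x ≤ 1) :
    questionMark (x / (1 + x)) = questionMark x / 2 := by
  rcases h0.eq_or_lt with rfl | h0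
  · simp [questionMark_zero]
  · have hp : 0 < 1 + x := by linarith
    have hinv : (x / (1 + x))⁻¹ = x⁻¹ + 1 := by field_simp
    rw [questionMark_rec (div_pos h0 hp) ((div_le_one hp).2 (by linarith)), hinv,
      questionMark_rec h0 h1, Int.floor_add_one, Int.fract_add_one, neg_add,
      zpow_add₀ (by norm_num : (2 : ℝ) ≠ 0)]
    norm_num
    ring

theorem exists_questionMark_eq_dyadic (n : ℕ) : ∀ k : ℕ, k ≤ 2 ^ n →
    ∃ x : ℝ, 0 ≤ x ∧ x ≤ 1 ∧ questionMark x = k / 2 ^ n := by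
  induction n with
  | zero =>
    intro k hk
    have hk' : k = 0 ∨ k = 1 := by
      rw [pow_zero] at hk
      omega
    rcases hk' with rfl | rfl
    · exact ⟨0, le_rfl, zero_le_one, by simp [questionMark_zero]⟩
    · exact ⟨1, zero_le_one, le_rfl, by simp [questionMark_one]⟩
  | succ n ih =>
    intro k hk
    rw [pow_succ] at hk
    rcases le_total k (2 ^ n) with h | h
    · obtain ⟨x, h0, h1, hx⟩ := ih k h
      have hp : 0 < 1 + x := by linarith
      refine ⟨x / (1 + x), by positivity, (div_le_one hp).2 (by linarith), ?_⟩
      rw [questionMark_div_one_add h0 h1, hx, pow_succ]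
      field_simp
    · obtain ⟨x, h0, h1, hx⟩ := ih (2 ^ n * 2 - k) (by omega)
      have hp : 0 < 1 + x := by linarith
      refine ⟨(1 + x)⁻¹, by positivity, inv_le_one_of_one_le₀ (by linarith), ?_⟩
      rw [questionMark_inv_one_add h0 h1, hx, pow_succ, Nat.cast_sub hk]
      push_cast
      field_simp
      ring

theorem questionMark_denseRange : DenseRange questionMark := by
  rw [Metric.denseRange_iff]
  intro z r hr
  obtain ⟨n, hn⟩ := exists_pow_lt_of_lt_one hr (by norm_num : (1 / 2 : ℝ) < 1)
  have hN : (0 : ℝ) < 2 ^ n := by positivity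
  set f := Int.fract z with hf
  have hf0 : 0 ≤ f := Int.fract_nonneg z
  have hf1 : f < 1 := Int.fract_lt_one z
  have hk1 : (⌊f * 2 ^ n⌋₊ : ℝ) ≤ f * 2 ^ n := Nat.floor_le (by positivity)
  have hk2 : f * 2 ^ n < ⌊f * 2 ^ n⌋₊ + 1 := Nat.lt_floor_add_one _
  have hk : ⌊f * 2 ^ n⌋₊ ≤ 2 ^ n := by
    have : (⌊f * 2 ^ n⌋₊ : ℝ) ≤ 2 ^ n := by nlinarith
    exact_mod_cast this
  obtain ⟨x, h0, h1, hx⟩ := exists_questionMark_eq_dyadic n _ hk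
  refine ⟨⌊z⌋ + x, ?_⟩
  have hper : questionMark (⌊z⌋ + x) = ⌊z⌋ + questionMark x := by
    rw [questionMark_eq_floor_add (⌊z⌋ + x), questionMark_eq_floor_add x, Int.floor_intCast_add,
      Int.fract_intCast_add]
    push_cast
    ring
  have hz : z = ⌊z⌋ + f := (Int.floor_add_fract z).symm
  have hd : z - questionMark (⌊z⌋ + x) = f - ⌊f * 2 ^ n⌋₊ / 2 ^ n := by
    rw [hper, hx]
    linarith
  have hq : f - ⌊f * 2 ^ n⌋₊ / 2 ^ n = (f * 2 ^ n - ⌊f * 2 ^ n⌋₊) * (1 / 2) ^ n := by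
    rw [one_div_pow]
    field_simp
  have hh : (0 : ℝ) < (1 / 2) ^ n := by positivity
  rw [Real.dist_eq, hd, hq, abs_of_nonneg (mul_nonneg (by linarith) hh.le)]
  nlinarith

theorem questionMark_continuous : Continuous questionMark :=
  questionMark_monotone.continuous_of_denseRange questionMark_denseRange

/-! ### The Minkowski measure and the constants attached to it -/

/-- The question mark function as a (continuous) Stieltjes function. -/
noncomputable def questionMarkStieltjes : StieltjesFunction ℝ where
  toFun := questionMark
  mono' := questionMark_monotone
  right_continuous' _ := questionMark_continuous.continuousWithinAt

/-- The Minkowski measure `d?(x)` on `[0, 1]`. -/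
noncomputable def minkowskiMeasure : Measure ℝ :=
  questionMarkStieltjes.measure.restrict (Set.Icc 0 1)

/-- The moments `m_L = ∫₀¹ x^L d?(x)`. -/
noncomputable def moment (L : ℕ) : ℝ := ∫ x, x ^ L ∂minkowskiMeasure

/-- The Laplace–Fourier transform `𝔪(t) = ∫₀¹ e^{xt} d?(x)`. -/
noncomputable def laplaceFourier (t : ℂ) : ℂ := ∫ x : ℝ, Complex.exp (x * t) ∂minkowskiMeasure

/-- The Fourier–Stieltjes coefficients `d_n = 𝔪(2πin)`. -/
noncomputable def coeff (n : ℕ) : ℂ := laplaceFourier (2 * Real.pi * Complex.I * n)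

/-- The partial sums `∑_{n=1}^N d_n / n^s`. -/
noncomputable def zetaPartialSum (s : ℂ) (N : ℕ) : ℂ :=
  ∑ n ∈ Finset.Icc 1 N, coeff n / (n : ℂ) ^ s

/-- The zeta function `𝔐(s) = ∑_{n=1}^∞ d_n / n^s`, the sum being the limit of the
partial sums (the series need not converge absolutely throughout `Re s > 0`). -/
noncomputable def zetaM (s : ℂ) : ℂ := limUnder atTop (zetaPartialSum s)

end Minkowski

namespace Minkowski

/-! ### Invariance properties of the Minkowski measure -/

/-! Summing `z ^ n / n` under the integral with `z = exp (2πix)` turns `𝔐(1)` into the integral of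
`-log (1 - z)`. The reflection `x ↦ 1 - x` preserves the measure, so the coefficients `d_n` are real
and only the real part `-log (2 sin πx)` matters (`tendsto_zetaPartialSum_one`). The exchange of
limit and integral is dominated by `x⁻¹ + (1 - x)⁻¹`, which is integrable by self-similarity of the
measure (`lintegral_min_inv_le`).

Euler's product for the sine, with the factor `1 - x²` split off and the other factors expanded,
gives `∑ (ζ(2n) - 1) x^(2n) / n = log π + log x + log (1 - x) + log (1 + x) - log sin πx`.
Integration leaves only logarithmic integrals. With `A = ∫ log (1 + x)`, self-similarity yields `∫
log x = -2A` (`integral_log`), and reflection gives `∫ log (1 - x)` the same value, so these terms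
add up to `-3A`. Finally `A = log 2 - ∑ m_n / (n 2^n)` (`hasSum_moment_div`), from the series of
`-log (1 - x/2)`. -/

/-- For `y ≤ 1/2` put `t = y / (1 - y)`. Then `y = t / (1 + t)` and `1 - y = 1 / (1 + t)`, and the
two functional equations of `?` at `t` give values with sum `1`. -/
theorem questionMark_one_sub {x : ℝ} (h0 : 0 ≤ x) (h1 : x ≤ 1) :
    questionMark (1 - x) = 1 - questionMark x := by
  have key : ∀ y : ℝ, 0 ≤ y → y ≤ 1 / 2 → questionMark (1 - y) = 1 - questionMark y := by
    intro y hy0 hy1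
    have hp : 0 < 1 - y := by linarith
    have ht0 : 0 ≤ y / (1 - y) := by positivity
    have ht1 : y / (1 - y) ≤ 1 := (div_le_one hp).2 (by linarith)
    have e : 1 + y / (1 - y) = (1 - y)⁻¹ := by field_simp; ring
    have h2 := questionMark_inv_one_add ht0 ht1
    have h3 := questionMark_div_one_add ht0 ht1
    rw [e, inv_inv] at h2
    rw [e, div_inv_eq_mul, div_mul_cancel₀ _ hp.ne'] at h3
    rw [h2, h3]
  rcases le_total x (1 / 2) with h | h
  · exact key x h0 h
  · have := key (1 - x) (by linarith) (by linarith)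
    rw [sub_sub_cancel] at this
    linarith

theorem measure_stieltjes_Icc {a b : ℝ} :
    questionMarkStieltjes.measure (Set.Icc a b) =
      ENNReal.ofReal (questionMark b - questionMark a) := by
  rw [StieltjesFunction.measure_Icc]
  congr 2
  exact questionMark_continuous.continuousWithinAt.leftLim_eq

theorem minkowskiMeasure_Iic {a : ℝ} (h1 : a ≤ 1) :
    minkowskiMeasure (Set.Iic a) = ENNReal.ofReal (questionMark a) := by
  rw [minkowskiMeasure, Measure.restrict_apply measurableSet_Iic]
  have : Set.Iic a ∩ Set.Icc 0 1 = Set.Icc 0 a := by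
    ext x
    simp only [Set.mem_inter_iff, Set.mem_Iic, Set.mem_Icc]
    constructor
    · rintro ⟨h, h', -⟩; exact ⟨h', h⟩
    · rintro ⟨h, h'⟩; exact ⟨h', h, h'.trans h1⟩
  rw [this, measure_stieltjes_Icc, questionMark_zero, sub_zero]

theorem minkowskiMeasure_Ici {a : ℝ} (h0 : 0 ≤ a) :
    minkowskiMeasure (Set.Ici a) = ENNReal.ofReal (1 - questionMark a) := by
  rw [minkowskiMeasure, Measure.restrict_apply measurableSet_Ici]
  have : Set.Ici a ∩ Set.Icc 0 1 = Set.Icc a 1 := by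
    ext x
    simp only [Set.mem_inter_iff, Set.mem_Ici, Set.mem_Icc]
    constructor
    · rintro ⟨h, -, h'⟩; exact ⟨h, h'⟩
    · rintro ⟨h, h'⟩; exact ⟨h, h0.trans h, h'⟩
  rw [this, measure_stieltjes_Icc, questionMark_one]

instance : IsProbabilityMeasure minkowskiMeasure where
  measure_univ := by
    rw [minkowskiMeasure, Measure.restrict_apply MeasurableSet.univ, Set.univ_inter,
      measure_stieltjes_Icc, questionMark_one, questionMark_zero]
    simp

theorem ae_mem_Icc : ∀ᵐ x ∂minkowskiMeasure, x ∈ Set.Icc (0 : ℝ) 1 :=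
  ae_restrict_mem measurableSet_Icc

/-- Continuity of `?` excludes atoms at the endpoints, which is where the integrands below are
singular. -/
theorem ae_mem_Ioo : ∀ᵐ x ∂minkowskiMeasure, x ∈ Set.Ioo (0 : ℝ) 1 := by
  have h0 : ∀ᵐ x ∂minkowskiMeasure, ¬ x ∈ Set.Iic (0 : ℝ) := by
    rw [← measure_eq_zero_iff_ae_notMem, minkowskiMeasure_Iic zero_le_one,
      questionMark_zero, ENNReal.ofReal_zero]
  have h1 : ∀ᵐ x ∂minkowskiMeasure, ¬ x ∈ Set.Ici (1 : ℝ) := by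
    rw [← measure_eq_zero_iff_ae_notMem, minkowskiMeasure_Ici zero_le_one,
      questionMark_one, sub_self, ENNReal.ofReal_zero]
  filter_upwards [h0, h1] with x h h'
  exact ⟨not_le.1 h, not_le.1 h'⟩

theorem minkowskiMeasure_congr {s t : Set ℝ}
    (h : ∀ x : ℝ, 0 ≤ x → x ≤ 1 → (x ∈ s ↔ x ∈ t)) :
    minkowskiMeasure s = minkowskiMeasure t := by
  apply measure_congr
  rw [Filter.eventuallyEq_set]
  filter_upwards [ae_mem_Icc] with x hx using h x hx.1 hx.2

theorem map_one_sub_minkowskiMeasure :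
    minkowskiMeasure.map (fun x => 1 - x) = minkowskiMeasure := by
  have hm : Measurable (fun x : ℝ => 1 - x) := by fun_prop
  refine Measure.ext_of_Iic _ _ fun a => ?_
  rw [Measure.map_apply hm measurableSet_Iic]
  rcases lt_or_ge a 0 with h0 | h0
  · apply minkowskiMeasure_congr
    intro x hx0 hx1
    simp only [Set.mem_preimage, Set.mem_Iic]
    constructor <;> intro <;> linarith
  rcases lt_or_ge 1 a with h1 | h1
  · apply minkowskiMeasure_congr
    intro x hx0 hx1
    simp only [Set.mem_preimage, Set.mem_Iic]
    constructor <;> intro <;> linarith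
  have : (fun x : ℝ => 1 - x) ⁻¹' Set.Iic a = Set.Ici (1 - a) := by
    ext x
    simp only [Set.mem_preimage, Set.mem_Iic, Set.mem_Ici]
    constructor <;> intro <;> linarith
  rw [this, minkowskiMeasure_Ici (by linarith), minkowskiMeasure_Iic h1,
    questionMark_one_sub h0 h1, sub_sub_cancel]

/-- Self-similarity: the two maps carry `[0, 1]` onto `[0, 1/2]` and `[1/2, 1]`, and by the
functional equations of `?` each half receives half of the mass. It suffices to compare distribution
functions, separately on the two sides of `1/2`. -/
theorem map_add_map_minkowskiMeasure :
    minkowskiMeasure.map (fun x => x / (1 + x)) + minkowskiMeasure.map (fun x => (1 + x)⁻¹)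
      = minkowskiMeasure + minkowskiMeasure := by
  have hm : Measurable (fun x : ℝ => x / (1 + x)) := by fun_prop
  have hm' : Measurable (fun x : ℝ => (1 + x)⁻¹) := by fun_prop
  refine Measure.ext_of_Iic _ _ fun a => ?_
  rw [Measure.add_apply, Measure.add_apply, Measure.map_apply hm measurableSet_Iic,
    Measure.map_apply hm' measurableSet_Iic]
  rcases lt_or_ge a 0 with h0 | h0
  · congr 1 <;>
    · apply minkowskiMeasure_congr
      intro x hx0 hx1
      have h2 : 0 ≤ x / (1 + x) := by positivity
      have h3 : 0 ≤ (1 + x)⁻¹ := by positivity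
      simp only [Set.mem_preimage, Set.mem_Iic]
      constructor <;> intro <;> linarith
  rcases lt_or_ge 1 a with h1 | h1
  · congr 1 <;>
    · apply minkowskiMeasure_congr
      intro x hx0 hx1
      have h2 : x / (1 + x) ≤ 1 := (div_le_one (by linarith)).2 (by linarith)
      have h3 : (1 + x)⁻¹ ≤ 1 := inv_le_one_of_one_le₀ (by linarith)
      simp only [Set.mem_preimage, Set.mem_Iic]
      constructor <;> intro <;> linarith
  have hq := questionMark_mem h0 h1
  rw [minkowskiMeasure_Iic h1]
  rcases lt_or_ge a (1 / 2) with h2 | h2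
  · have hp : 0 < 1 - a := by linarith
    -- The point `a / (1 - a)` is the preimage of `a` under `x ↦ x / (1 + x)`; below, `a⁻¹ - 1`
    -- plays this role for the decreasing map `x ↦ (1 + x)⁻¹`.
    have ht0 : 0 ≤ a / (1 - a) := by positivity
    have ht1 : a / (1 - a) ≤ 1 := (div_le_one hp).2 (by linarith)
    have e : 1 + a / (1 - a) = (1 - a)⁻¹ := by field_simp; ring
    have h3 := questionMark_div_one_add ht0 ht1
    rw [e, div_inv_eq_mul, div_mul_cancel₀ _ hp.ne'] at h3
    have e1 : minkowskiMeasure ((fun x => x / (1 + x)) ⁻¹' Set.Iic a)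
        = minkowskiMeasure (Set.Iic (a / (1 - a))) := by
      apply minkowskiMeasure_congr
      intro x hx0 hx1
      simp only [Set.mem_preimage, Set.mem_Iic]
      rw [div_le_iff₀ (by linarith), le_div_iff₀ hp]
      constructor <;> intro <;> linarith
    have e2 : minkowskiMeasure ((fun x => (1 + x)⁻¹) ⁻¹' Set.Iic a)
        = minkowskiMeasure ∅ := by
      apply minkowskiMeasure_congr
      intro x hx0 hx1
      simp only [Set.mem_preimage, Set.mem_Iic, Set.mem_empty_iff_false, iff_false, not_le]
      have h4 : (2 : ℝ)⁻¹ ≤ (1 + x)⁻¹ := inv_anti₀ (by linarith) (by linarith)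
      linarith
    rw [e1, e2, minkowskiMeasure_Iic ht1, measure_empty, add_zero,
      ← ENNReal.ofReal_add hq.1 hq.1]
    congr 1
    linarith
  · have hp : 0 < a := by linarith
    have ht0 : 0 ≤ a⁻¹ - 1 := sub_nonneg.2 ((one_le_inv₀ hp).2 h1)
    have ht1 : a⁻¹ - 1 ≤ 1 := by
      have : a⁻¹ ≤ 2 := by rw [inv_le_comm₀ hp (by norm_num)]; linarith
      linarith
    have h3 := questionMark_inv_one_add ht0 ht1
    rw [add_sub_cancel, inv_inv] at h3
    have e1 : minkowskiMeasure ((fun x => x / (1 + x)) ⁻¹' Set.Iic a)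
        = minkowskiMeasure Set.univ := by
      apply minkowskiMeasure_congr
      intro x hx0 hx1
      simp only [Set.mem_preimage, Set.mem_Iic, Set.mem_univ, iff_true]
      rw [div_le_iff₀ (by linarith)]
      nlinarith
    have e2 : minkowskiMeasure ((fun x => (1 + x)⁻¹) ⁻¹' Set.Iic a)
        = minkowskiMeasure (Set.Ici (a⁻¹ - 1)) := by
      apply minkowskiMeasure_congr
      intro x hx0 hx1
      simp only [Set.mem_preimage, Set.mem_Iic, Set.mem_Ici]
      rw [inv_le_comm₀ (by linarith) hp]
      constructor <;> intro <;> linarith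
    have hq' := questionMark_mem ht0 ht1
    rw [e1, e2, minkowskiMeasure_Ici ht0, measure_univ, ← ENNReal.ofReal_one,
      ← ENNReal.ofReal_add hq.1 hq.1, ← ENNReal.ofReal_add zero_le_one (by linarith)]
    congr 1
    linarith

theorem integral_comp_one_sub {E : Type*} [NormedAddCommGroup E] [NormedSpace ℝ E] (f : ℝ → E) :
    ∫ x, f (1 - x) ∂minkowskiMeasure = ∫ x, f x ∂minkowskiMeasure := by
  conv_rhs => rw [← map_one_sub_minkowskiMeasure]
  exact (MeasurableEmbedding.integral_map
    (MeasurableEquiv.subLeft (1 : ℝ)).measurableEmbedding f).symm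

theorem integrable_comp_one_sub {f : ℝ → ℝ} (hf : Integrable f minkowskiMeasure) :
    Integrable (fun x => f (1 - x)) minkowskiMeasure := by
  rw [← map_one_sub_minkowskiMeasure] at hf
  exact hf.comp_measurable (by fun_prop)

theorem integral_comp_add_integral_comp {f : ℝ → ℝ} (hf : Integrable f minkowskiMeasure) :
    ∫ x, f (x / (1 + x)) ∂minkowskiMeasure + ∫ x, f (1 + x)⁻¹ ∂minkowskiMeasure
      = 2 * ∫ x, f x ∂minkowskiMeasure := by
  have hm : Measurable (fun x : ℝ => x / (1 + x)) := by fun_prop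
  have hm' : Measurable (fun x : ℝ => (1 + x)⁻¹) := by fun_prop
  have h2 : Integrable f (minkowskiMeasure + minkowskiMeasure) := hf.add_measure hf
  have h3 := h2
  rw [← map_add_map_minkowskiMeasure, integrable_add_measure] at h3
  rw [← integral_map hm.aemeasurable h3.1.1, ← integral_map hm'.aemeasurable h3.2.1,
    ← integral_add_measure h3.1 h3.2, map_add_map_minkowskiMeasure, integral_add_measure hf hf,
    two_mul]

/-- Let `f` be the truncation of `1/x` at `N`. Since `1 / (x / (1 + x)) = 1/x + 1` and `1 / (1 +
x)⁻¹ ≤ 2`, self-similarity gives `2 ∫ f ≤ (∫ f + 1) + 2`. The truncation makes `∫ f` finite, so it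
may be cancelled; the resulting bound does not depend on `N`. -/
theorem lintegral_min_inv_le (N : ℕ) :
    ∫⁻ x, min (ENNReal.ofReal x⁻¹) N ∂minkowskiMeasure ≤ 3 := by
  have hm : Measurable (fun x : ℝ => x / (1 + x)) := by fun_prop
  have hm' : Measurable (fun x : ℝ => (1 + x)⁻¹) := by fun_prop
  set f : ℝ → ENNReal := fun x => min (ENNReal.ofReal x⁻¹) N with hf
  have hfm : Measurable f := by fun_prop
  have hfin : ∫⁻ x, f x ∂minkowskiMeasure ≠ ⊤ := by
    refine ne_top_of_le_ne_top (ENNReal.natCast_ne_top N) ?_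
    calc ∫⁻ x, f x ∂minkowskiMeasure ≤ ∫⁻ _, N ∂minkowskiMeasure :=
          lintegral_mono fun x => min_le_right _ _
      _ = N := by simp
  have key : ∫⁻ x, f (x / (1 + x)) ∂minkowskiMeasure + ∫⁻ x, f (1 + x)⁻¹ ∂minkowskiMeasure
      = ∫⁻ x, f x ∂minkowskiMeasure + ∫⁻ x, f x ∂minkowskiMeasure := by
    rw [← lintegral_map hfm hm, ← lintegral_map hfm hm', ← lintegral_add_measure,
      map_add_map_minkowskiMeasure, lintegral_add_measure]
  have h1 : ∫⁻ x, f (x / (1 + x)) ∂minkowskiMeasure ≤ ∫⁻ x, (f x + 1) ∂minkowskiMeasure := by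
    apply lintegral_mono_ae
    filter_upwards [ae_mem_Ioo] with x hx
    have hx0 := hx.1
    have e : (x / (1 + x))⁻¹ = x⁻¹ + 1 := by field_simp
    simp only [hf, e]
    rw [ENNReal.ofReal_add (by positivity) zero_le_one, ENNReal.ofReal_one, ← min_add_add_right]
    exact min_le_min le_rfl le_self_add
  have h2 : ∫⁻ x, f (1 + x)⁻¹ ∂minkowskiMeasure ≤ ∫⁻ _, 2 ∂minkowskiMeasure := by
    apply lintegral_mono_ae
    filter_upwards [ae_mem_Ioo] with x hx
    refine (min_le_left _ _).trans ?_
    rw [inv_inv]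
    exact ENNReal.ofReal_le_of_le_toReal (by simp; linarith [hx.2])
  rw [lintegral_add_right _ measurable_const] at h1
  simp only [lintegral_const, measure_univ, mul_one] at h1 h2
  have h3 := key.symm.le.trans (add_le_add h1 h2)
  rw [add_assoc] at h3
  have h4 := (ENNReal.add_le_add_iff_left hfin).1 h3
  refine h4.trans (by norm_num)

theorem integrable_inv : Integrable (fun x : ℝ => x⁻¹) minkowskiMeasure := by
  refine ⟨by fun_prop, ?_⟩
  rw [hasFiniteIntegral_iff_ofReal
    (by filter_upwards [ae_mem_Ioo] with x hx using inv_nonneg.2 hx.1.le)]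
  -- Monotone convergence removes the truncation.
  have e : ∀ x : ℝ, ENNReal.ofReal x⁻¹ = ⨆ N : ℕ, min (ENNReal.ofReal x⁻¹) N := by
    intro x
    rw [← inf_iSup_eq, ENNReal.iSup_natCast, inf_top_eq]
  rw [lintegral_congr e, lintegral_iSup
    (f := fun (N : ℕ) x => min (ENNReal.ofReal x⁻¹) (N : ENNReal)) (fun N => by fun_prop)
    (fun N M h x => min_le_min le_rfl (by exact_mod_cast h))]
  exact (iSup_le lintegral_min_inv_le).trans_lt (by norm_num)

/-! ### The power series of the logarithm on the unit circle -/

theorem norm_one_sub_mul_sum_pow_div_le {z : ℂ} (hz : ‖z‖ = 1) (N : ℕ) :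
    ‖(1 - z) * ∑ n ∈ Finset.range N, z ^ (n + 1) / ((n : ℂ) + 1)‖ ≤ 2 := by
  -- Summation by parts. Once the boundary term is added, what remains is `z` minus terms whose
  -- norms are consecutive differences of reciprocals, and these telescope to `1 - 1 / (N + 1)`.
  -- Removing the boundary term costs exactly the missing `1 / (N + 1)`.
  have key : ∀ N : ℕ, ‖(1 - z) * ∑ n ∈ Finset.range (N + 1), z ^ (n + 1) / ((n : ℂ) + 1)
      + z ^ (N + 2) / ((N : ℂ) + 1)‖ ≤ 2 - 1 / ((N : ℝ) + 1) := by
    intro N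
    induction N with
    | zero =>
      have : (1 - z) * z + z ^ 2 = z := by ring
      simp [this, hz]
      norm_num
    | succ N ih =>
      have h1 : (N : ℂ) + 1 ≠ 0 := by exact_mod_cast N.succ_ne_zero
      have h2 : (N : ℂ) + 1 + 1 ≠ 0 := by exact_mod_cast (N + 1).succ_ne_zero
      have e : (1 - z) * ∑ n ∈ Finset.range (N + 1 + 1), z ^ (n + 1) / ((n : ℂ) + 1)
          + z ^ (N + 1 + 2) / (((N + 1 : ℕ) : ℂ) + 1)
          = ((1 - z) * ∑ n ∈ Finset.range (N + 1), z ^ (n + 1) / ((n : ℂ) + 1)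
            + z ^ (N + 2) / ((N : ℂ) + 1))
            - z ^ (N + 2) * ((1 / ((N : ℝ) + 1) - 1 / ((N : ℝ) + 1 + 1) : ℝ) : ℂ) := by
        rw [Finset.sum_range_succ _ (N + 1)]
        push_cast
        field_simp
        ring
      have hd : (0 : ℝ) ≤ 1 / ((N : ℝ) + 1) - 1 / ((N : ℝ) + 1 + 1) := by
        rw [sub_nonneg]
        exact one_div_le_one_div_of_le (by positivity) (by linarith)
      rw [e]
      refine (norm_sub_le _ _).trans ?_
      rw [norm_mul, norm_pow, hz, one_pow, one_mul, Complex.norm_real, Real.norm_of_nonneg hd]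
      push_cast
      linarith
  cases N with
  | zero => simp
  | succ N =>
    have h := key N
    have hn : ‖z ^ (N + 2) / ((N : ℂ) + 1)‖ = 1 / ((N : ℝ) + 1) := by
      rw [norm_div, norm_pow, hz, one_pow]
      congr 1
      exact_mod_cast Complex.norm_natCast (N + 1)
    calc _ = ‖((1 - z) * ∑ n ∈ Finset.range (N + 1), z ^ (n + 1) / ((n : ℂ) + 1)
          + z ^ (N + 2) / ((N : ℂ) + 1)) - z ^ (N + 2) / ((N : ℂ) + 1)‖ := by
          rw [add_sub_cancel_right]
      _ ≤ _ := (norm_sub_le _ _).trans (by rw [hn]; linarith)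

theorem norm_sum_pow_div_le {z : ℂ} (hz : ‖z‖ = 1) (hz1 : z ≠ 1) (N : ℕ) :
    ‖∑ n ∈ Finset.range N, z ^ (n + 1) / ((n : ℂ) + 1)‖ ≤ 2 / ‖1 - z‖ := by
  have h : 0 < ‖1 - z‖ := norm_pos_iff.2 (sub_ne_zero.2 hz1.symm)
  rw [le_div_iff₀ h, mul_comm, ← norm_mul]
  exact norm_one_sub_mul_sum_pow_div_le hz N

theorem one_sub_mem_slitPlane {z : ℂ} (hz : ‖z‖ = 1) (hz1 : z ≠ 1) :
    1 - z ∈ Complex.slitPlane := by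
  rw [Complex.mem_slitPlane_iff]
  by_contra! h
  have h1 := Complex.re_le_norm z
  simp only [Complex.sub_re, Complex.one_re, Complex.sub_im, Complex.one_im] at h
  apply hz1
  apply Complex.ext
  · simp only [Complex.one_re]; linarith
  · simp only [Complex.one_im]; linarith [h.2]

/-- Dirichlet's test gives convergence on the circle; Abel's limit theorem then identifies the sum
with the radial limit of `-log (1 - rz)`, since `log` is continuous at `1 - z`. -/
theorem tendsto_sum_pow_div {z : ℂ} (hz : ‖z‖ = 1) (hz1 : z ≠ 1) :
    Tendsto (fun N => ∑ n ∈ Finset.range N, z ^ (n + 1) / ((n : ℂ) + 1)) atTop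
      (𝓝 (-Complex.log (1 - z))) := by
  have hpos : 0 < ‖1 - z‖ := norm_pos_iff.2 (sub_ne_zero.2 hz1.symm)
  have hanti : Antitone (fun n : ℕ => 1 / ((n : ℝ) + 1)) := by
    intro m n h
    have : (m : ℝ) ≤ n := by exact_mod_cast h
    exact one_div_le_one_div_of_le (by positivity) (by linarith)
  have hb : ∀ n, ‖∑ i ∈ Finset.range n, z ^ i‖ ≤ 2 / ‖1 - z‖ := by
    intro n
    rw [le_div_iff₀ hpos, ← norm_mul, geom_sum_mul_neg]
    refine (norm_sub_le _ _).trans ?_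
    rw [norm_pow, hz]
    norm_num
  have hc := hanti.cauchySeq_series_mul_of_tendsto_zero_of_bounded
    tendsto_one_div_add_atTop_nhds_zero_nat hb
  obtain ⟨l, hl⟩ := cauchySeq_tendsto_of_complete hc
  have habel := Complex.tendsto_tsum_powerSeries_nhdsWithin_lt hl
  rw [tendsto_map'_iff] at habel
  have hr : Tendsto (fun r : ℝ => (r : ℂ)) (𝓝[<] 1) (𝓝 1) :=
    (Complex.continuous_ofReal.tendsto' 1 1 (by simp)).mono_left nhdsWithin_le_nhds
  have hlog : Tendsto (fun r : ℝ => -Complex.log (1 - z * r)) (𝓝[<] 1)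
      (𝓝 (-Complex.log (1 - z))) := by
    have h1 : Tendsto (fun r : ℝ => 1 - z * r) (𝓝[<] 1) (𝓝 (1 - z)) := by
      simpa using (hr.const_mul z).const_sub 1
    exact (h1.clog (one_sub_mem_slitPlane hz hz1)).neg
  -- The series handled by Abel's theorem has coefficients `z ^ n / (n + 1)`; the factor `z * r`
  -- shifts it to the logarithmic series.
  have hev : (fun r : ℝ => z * r * ∑' n : ℕ, ((1 / ((n : ℝ) + 1)) • z ^ n) * (r : ℂ) ^ n)
      =ᶠ[𝓝[<] 1] fun r : ℝ => -Complex.log (1 - z * r) := by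
    filter_upwards [Ioo_mem_nhdsLT (show (0 : ℝ) < 1 by norm_num)] with r hr
    have hlt : ‖z * r‖ < 1 := by
      rw [norm_mul, hz, one_mul, Complex.norm_real, Real.norm_of_nonneg hr.1.le]
      exact hr.2
    have hs := (hasSum_nat_add_iff' 1).2 (Complex.hasSum_taylorSeries_neg_log hlt)
    simp only [Finset.sum_range_one, pow_zero, Nat.cast_zero, div_zero, sub_zero] at hs
    rw [← hs.tsum_eq, ← tsum_mul_left]
    refine tsum_congr fun n => ?_
    rw [Complex.real_smul]
    push_cast
    ring
  have hlim := (((hr.const_mul z).mul habel).congr' hev)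
  have hzl := tendsto_nhds_unique hlim hlog
  rw [mul_one] at hzl
  rw [← hzl]
  refine (hl.const_mul z).congr fun N => ?_
  rw [Finset.mul_sum]
  refine Finset.sum_congr rfl fun n _ => ?_
  rw [Complex.real_smul]
  push_cast
  ring

/-! ### Convergence of the Dirichlet series at `s = 1` -/

theorem norm_one_sub_exp {x : ℝ} (h0 : 0 ≤ x) (h1 : x ≤ 1) :
    ‖1 - Complex.exp (2 * Real.pi * Complex.I * x)‖ = 2 * Real.sin (Real.pi * x) := by
  have e : (2 * Real.pi * Complex.I * x : ℂ) = Complex.I * ((2 * Real.pi * x : ℝ) : ℂ) := by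
    push_cast; ring
  rw [norm_sub_rev, e, Complex.norm_exp_I_mul_ofReal_sub_one, Real.norm_of_nonneg]
  · congr 2; ring
  · have : 0 ≤ Real.sin (2 * Real.pi * x / 2) := by
      apply Real.sin_nonneg_of_nonneg_of_le_pi
      · have := Real.pi_pos; positivity
      · nlinarith [Real.pi_pos]
    positivity

theorem sin_pi_mul_pos {x : ℝ} (hx : x ∈ Set.Ioo (0 : ℝ) 1) : 0 < Real.sin (Real.pi * x) := by
  apply Real.sin_pos_of_pos_of_lt_pi
  · exact mul_pos Real.pi_pos hx.1
  · nlinarith [Real.pi_pos, hx.2]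

theorem norm_exp_two_pi_I_mul (x : ℝ) : ‖Complex.exp (2 * Real.pi * Complex.I * x)‖ = 1 := by
  have e : (2 * Real.pi * Complex.I * x : ℂ) = ((2 * Real.pi * x : ℝ) : ℂ) * Complex.I := by
    push_cast; ring
  rw [e, Complex.norm_exp_ofReal_mul_I]

theorem exp_two_pi_I_mul_ne_one {x : ℝ} (hx : x ∈ Set.Ioo (0 : ℝ) 1) :
    Complex.exp (2 * Real.pi * Complex.I * x) ≠ 1 := by
  intro h
  have := norm_one_sub_exp hx.1.le hx.2.le
  rw [h, sub_self, norm_zero] at this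
  linarith [sin_pi_mul_pos hx]

/-- Jordan's inequality `sin u ≥ 2u / π` handles `x ≤ 1/2`, and the symmetry of the sine about `π /
2` the other half. -/
theorem two_div_norm_one_sub_exp_le {x : ℝ} (hx : x ∈ Set.Ioo (0 : ℝ) 1) :
    2 / ‖1 - Complex.exp (2 * Real.pi * Complex.I * x)‖ ≤ x⁻¹ + (1 - x)⁻¹ := by
  have key : ∀ y : ℝ, 0 < y → y ≤ 1 / 2 → 1 / Real.sin (Real.pi * y) ≤ y⁻¹ := by
    intro y h0 h1
    have h2 : 2 / Real.pi * (Real.pi * y) ≤ Real.sin (Real.pi * y) :=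
      Real.mul_le_sin (by have := Real.pi_pos; positivity) (by nlinarith [Real.pi_pos])
    have e : 2 / Real.pi * (Real.pi * y) = 2 * y := by have := Real.pi_ne_zero; field_simp
    rw [← one_div]
    exact one_div_le_one_div_of_le h0 (by linarith)
  have h1 := hx.1
  have h2 : 0 < 1 - x := sub_pos.2 hx.2
  have e : 2 / (2 * Real.sin (Real.pi * x)) = 1 / Real.sin (Real.pi * x) := by
    have := (sin_pi_mul_pos hx).ne'
    field_simp
  rw [norm_one_sub_exp hx.1.le hx.2.le, e]
  have p1 : 0 < x⁻¹ := by positivity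
  have p2 : 0 < (1 - x)⁻¹ := by positivity
  rcases le_total x (1 / 2) with h | h
  · linarith [key x h1 h]
  · have := key (1 - x) h2 (by linarith)
    rw [show Real.pi * (1 - x) = Real.pi - Real.pi * x by ring, Real.sin_pi_sub] at this
    linarith

theorem zetaPartialSum_one (N : ℕ) :
    zetaPartialSum 1 N = ∫ x : ℝ, ∑ n ∈ Finset.range N,
      Complex.exp (2 * Real.pi * Complex.I * x) ^ (n + 1) / ((n : ℂ) + 1) ∂minkowskiMeasure := by
  have hint : ∀ n : ℕ, Integrable (fun x : ℝ =>
      Complex.exp (2 * Real.pi * Complex.I * x) ^ (n + 1)) minkowskiMeasure := by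
    intro n
    refine Integrable.of_bound (by fun_prop) 1 (Eventually.of_forall fun x => ?_)
    rw [norm_pow, norm_exp_two_pi_I_mul, one_pow]
  rw [integral_finsetSum _ fun n _ => (hint n).div_const _]
  unfold zetaPartialSum
  rw [show Finset.Icc 1 N = Finset.Ico (0 + 1) (N + 1) from rfl,
    ← Finset.sum_Ico_add', Finset.range_eq_Ico]
  refine Finset.sum_congr rfl fun n _ => ?_
  rw [integral_div, coeff, laplaceFourier, Complex.cpow_one, Nat.cast_add_one]
  congr 1
  refine integral_congr_ae (Eventually.of_forall fun x => ?_)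
  simp only [← Complex.exp_nat_mul]
  congr 1
  push_cast
  ring

theorem conj_coeff (n : ℕ) : (starRingEnd ℂ) (coeff n) = coeff n := by
  unfold coeff laplaceFourier
  rw [← integral_conj, ← integral_comp_one_sub]
  refine integral_congr_ae (Eventually.of_forall fun x => ?_)
  simp only [← Complex.exp_conj]
  rw [Complex.exp_eq_exp_iff_exists_int]
  -- After the reflection the exponents differ by `-2πin`, a period of `exp`.
  refine ⟨-n, ?_⟩
  simp only [map_mul, Complex.conj_ofReal, Complex.conj_I, map_natCast, map_ofNat]
  push_cast
  ring

theorem integrable_inv_add_inv :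
    Integrable (fun x : ℝ => x⁻¹ + (1 - x)⁻¹) minkowskiMeasure :=
  integrable_inv.add (integrable_comp_one_sub integrable_inv)

theorem tendsto_zetaPartialSum_one_integral :
    Tendsto (zetaPartialSum 1) atTop
      (𝓝 (∫ x : ℝ, -Complex.log (1 - Complex.exp (2 * Real.pi * Complex.I * x))
        ∂minkowskiMeasure)) := by
  simp_rw [funext zetaPartialSum_one]
  refine tendsto_integral_of_dominated_convergence _ (fun N => by fun_prop)
    integrable_inv_add_inv (fun N => ?_) ?_
  · filter_upwards [ae_mem_Ioo] with x hx
    exact (norm_sum_pow_div_le (norm_exp_two_pi_I_mul x) (exp_two_pi_I_mul_ne_one hx) N).trans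
      (two_div_norm_one_sub_exp_le hx)
  · filter_upwards [ae_mem_Ioo] with x hx
    exact tendsto_sum_pow_div (norm_exp_two_pi_I_mul x) (exp_two_pi_I_mul_ne_one hx)

theorem integrable_neg_log_one_sub_exp :
    Integrable (fun x : ℝ => -Complex.log (1 - Complex.exp (2 * Real.pi * Complex.I * x)))
      minkowskiMeasure := by
  have hm : Measurable
      (fun x : ℝ => -Complex.log (1 - Complex.exp (2 * Real.pi * Complex.I * x))) := by fun_prop
  refine integrable_inv_add_inv.mono' hm.aestronglyMeasurable ?_
  filter_upwards [ae_mem_Ioo] with x hx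
  refine (le_of_tendsto (tendsto_sum_pow_div (norm_exp_two_pi_I_mul x)
    (exp_two_pi_I_mul_ne_one hx)).norm (Eventually.of_forall fun N => ?_)).trans
      (two_div_norm_one_sub_exp_le hx)
  exact norm_sum_pow_div_le (norm_exp_two_pi_I_mul x) (exp_two_pi_I_mul_ne_one hx) N

theorem tendsto_zetaPartialSum_one :
    Tendsto (zetaPartialSum 1) atTop
      (𝓝 ((∫ x : ℝ, -Real.log (2 * Real.sin (Real.pi * x)) ∂minkowskiMeasure : ℝ) : ℂ)) := by
  have h := tendsto_zetaPartialSum_one_integral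
  set l := ∫ x : ℝ, -Complex.log (1 - Complex.exp (2 * Real.pi * Complex.I * x))
    ∂minkowskiMeasure with hl
  -- The limit is real because all partial sums are, so the argument of `1 - z` never has to be
  -- integrated.
  have hc : (starRingEnd ℂ) l = l := by
    refine tendsto_nhds_unique ?_ h
    refine ((Complex.continuous_conj.tendsto l).comp h).congr fun N => ?_
    simp [zetaPartialSum, conj_coeff]
  have hre : l.re = ∫ x : ℝ, -Real.log (2 * Real.sin (Real.pi * x)) ∂minkowskiMeasure := by
    have := integral_re (𝕜 := ℂ) integrable_neg_log_one_sub_exp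
    simp only [RCLike.re_to_complex] at this
    rw [hl, ← this]
    refine integral_congr_ae ?_
    filter_upwards [ae_mem_Icc] with x hx
    rw [Complex.neg_re, Complex.log_re, norm_one_sub_exp hx.1 hx.2]
  rw [← hre, Complex.conj_eq_iff_re.1 hc]
  exact h

/-! ### Values of the zeta function at even integers -/

/-- The number `ζ(2(k+1)) - 1`, as the sum `∑_{j ≥ 2} j^{-2(k+1)}`. -/
noncomputable def zetaEvenSubOne (k : ℕ) : ℝ := ∑' j : ℕ, 1 / ((j : ℝ) + 2) ^ (2 * (k + 1))

theorem summable_one_div_add_two_pow (k : ℕ) :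
    Summable (fun j : ℕ => 1 / ((j : ℝ) + 2) ^ (2 * (k + 1))) := by
  have h := (summable_nat_add_iff 2).2
    (Real.summable_one_div_nat_pow.2 (show 1 < 2 * (k + 1) by omega))
  exact_mod_cast h

theorem zetaEvenSubOne_nonneg (k : ℕ) : 0 ≤ zetaEvenSubOne k :=
  tsum_nonneg fun _ => by positivity

theorem riemannZeta_even_sub_one (k : ℕ) :
    riemannZeta (2 * ((k : ℂ) + 1)) - 1 = (zetaEvenSubOne k : ℂ) := by
  have h1 : 1 < 2 * (k + 1) := by omega
  have h := zeta_nat_eq_tsum_of_gt_one h1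
  push_cast at h
  have hs : Summable (fun n : ℕ => 1 / (n : ℝ) ^ (2 * (k + 1))) :=
    Real.summable_one_div_nat_pow.2 h1
  have e := hs.sum_add_tsum_nat_add 2
  have e' : ∑' n : ℕ, 1 / (n : ℂ) ^ (2 * (k + 1))
      = ((∑' n : ℕ, 1 / (n : ℝ) ^ (2 * (k + 1)) : ℝ) : ℂ) := by
    push_cast
    rfl
  rw [h, e', ← e, Finset.sum_range_succ, Finset.sum_range_one]
  simp [zetaEvenSubOne]

/-- Every base is at least `2`, so each term loses a factor of at least `4 ^ k` compared with `k =
0`. -/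
theorem zetaEvenSubOne_le (k : ℕ) : zetaEvenSubOne k ≤ zetaEvenSubOne 0 * (1 / 4) ^ k := by
  unfold zetaEvenSubOne
  rw [← tsum_mul_right]
  refine (summable_one_div_add_two_pow k).tsum_le_tsum (fun j => ?_)
    ((summable_one_div_add_two_pow 0).mul_right _)
  have h4 : (4 : ℝ) ≤ ((j : ℝ) + 2) ^ 2 := by nlinarith [(Nat.cast_nonneg j : (0 : ℝ) ≤ j)]
  have h : (4 : ℝ) ^ k ≤ (((j : ℝ) + 2) ^ 2) ^ k := pow_le_pow_left₀ (by norm_num) h4 k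
  rw [one_div_pow, div_mul_div_comm, one_mul, mul_add, pow_add, pow_mul]
  refine one_div_le_one_div_of_le (by positivity) ?_
  norm_num only [zero_add, mul_one]
  rw [mul_comm]
  gcongr

/-! ### The logarithm of the sine -/

theorem tendsto_sum_log_sin_factors {x : ℝ} (hx : x ∈ Set.Ioo (0 : ℝ) 1) :
    Tendsto (fun n => ∑ j ∈ Finset.range n, -Real.log (1 - x ^ 2 / ((j : ℝ) + 2) ^ 2)) atTop
      (𝓝 (Real.log Real.pi + Real.log x + Real.log (1 - x) + Real.log (1 + x)
        - Real.log (Real.sin (Real.pi * x)))) := by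
  have hp := Real.pi_pos
  have hx0 := hx.1
  have h1x : 0 < 1 - x := sub_pos.2 hx.2
  have h1x' : 0 < 1 + x := by linarith
  have hsin := sin_pi_mul_pos hx
  have hfac : ∀ j : ℕ, 0 < 1 - x ^ 2 / ((j : ℝ) + 2) ^ 2 := by
    intro j
    have hj : (0 : ℝ) ≤ j := Nat.cast_nonneg j
    rw [sub_pos, div_lt_one (by positivity)]
    nlinarith [hx.2]
  -- The index shift makes the first Euler factor `1 - x² = (1 - x)(1 + x)` available for splitting
  -- off.
  have h := (tendsto_add_atTop_iff_nat 1).2 (Real.tendsto_euler_sin_prod x)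
  have h2 := h.log hsin.ne'
  refine (h2.const_sub (Real.log Real.pi + Real.log x + Real.log (1 - x)
    + Real.log (1 + x))).congr fun n => ?_
  have e1 : (1 : ℝ) - x ^ 2 / (((0 : ℕ) : ℝ) + 1) ^ 2 = (1 - x) * (1 + x) := by
    push_cast
    ring
  have e2 : ∀ j : ℕ, (1 : ℝ) - x ^ 2 / (((j + 1 : ℕ) : ℝ) + 1) ^ 2
      = 1 - x ^ 2 / ((j : ℝ) + 2) ^ 2 := by
    intro j
    push_cast
    ring
  rw [Finset.prod_range_succ', e1]
  simp only [e2]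
  have hprod : 0 < ∏ j ∈ Finset.range n, (1 - x ^ 2 / ((j : ℝ) + 2) ^ 2) :=
    Finset.prod_pos fun j _ => hfac j
  rw [Real.log_mul (mul_pos hp hx0).ne' (mul_pos hprod (mul_pos h1x h1x')).ne',
    Real.log_mul hp.ne' hx0.ne',
    Real.log_mul hprod.ne' (mul_pos h1x h1x').ne', Real.log_mul h1x.ne' h1x'.ne',
    Real.log_prod (fun j _ => (hfac j).ne'), Finset.sum_neg_distrib]
  ring

/-- Each `-log (1 - x² / j²)` with `j ≥ 2` expands in powers of `x² / j²`. All terms are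
nonnegative, so convergence of the iterated sum permits the exchange, and summing over `j` first
produces `ζ(2(k+1)) - 1`. -/
theorem tsum_zetaEvenSubOne_mul_pow {x : ℝ} (hx : x ∈ Set.Ioo (0 : ℝ) 1) :
    ∑' k : ℕ, zetaEvenSubOne k / ((k : ℝ) + 1) * x ^ (2 * (k + 1))
      = Real.log Real.pi + Real.log x + Real.log (1 - x) + Real.log (1 + x)
        - Real.log (Real.sin (Real.pi * x)) := by
  have hlt : ∀ j : ℕ, |x ^ 2 / ((j : ℝ) + 2) ^ 2| < 1 := by
    intro j
    have hj : (0 : ℝ) ≤ j := Nat.cast_nonneg j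
    rw [abs_of_nonneg (by positivity), div_lt_one (by positivity)]
    nlinarith [hx.2, hx.1]
  have hk := fun j => Real.hasSum_pow_div_log_of_abs_lt_one (hlt j)
  have hj : HasSum (fun j : ℕ => -Real.log (1 - x ^ 2 / ((j : ℝ) + 2) ^ 2)) _ :=
    (hasSum_iff_tendsto_nat_of_nonneg (fun j => by
      rw [← (hk j).tsum_eq]
      exact tsum_nonneg fun k => by positivity) _).2 (tendsto_sum_log_sin_factors hx)
  have hterm : ∀ j k : ℕ, (x ^ 2 / ((j : ℝ) + 2) ^ 2) ^ (k + 1) / ((k : ℝ) + 1)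
      = x ^ (2 * (k + 1)) / ((k : ℝ) + 1) * (1 / ((j : ℝ) + 2) ^ (2 * (k + 1))) := by
    intro j k
    rw [div_pow, ← pow_mul, ← pow_mul]
    ring
  have hsum : Summable (Function.uncurry fun j k : ℕ =>
      (x ^ 2 / ((j : ℝ) + 2) ^ 2) ^ (k + 1) / ((k : ℝ) + 1)) := by
    refine (summable_prod_of_nonneg fun p => ?_).2 ⟨fun j => (hk j).summable, ?_⟩
    · simp only [Function.uncurry, Pi.zero_apply]
      positivity
    · exact hj.summable.congr fun j => ((hk j).tsum_eq).symm
  have hcomm := hsum.tsum_comm' (fun j => (hk j).summable) (fun k => by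
    simp only [hterm]
    exact (summable_one_div_add_two_pow k).mul_left _)
  rw [tsum_congr fun j => (hk j).tsum_eq, hj.tsum_eq] at hcomm
  rw [← hcomm]
  refine tsum_congr fun k => ?_
  simp only [hterm, tsum_mul_left, zetaEvenSubOne]
  ring

/-! ### Integration against the Minkowski measure -/

theorem moment_nonneg (L : ℕ) : 0 ≤ moment L := by
  refine integral_nonneg_of_ae ?_
  filter_upwards [ae_mem_Icc] with x hx using pow_nonneg hx.1 L

theorem integrable_pow (L : ℕ) : Integrable (fun x : ℝ => x ^ L) minkowskiMeasure := by
  refine Integrable.of_bound (by fun_prop) 1 ?_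
  filter_upwards [ae_mem_Icc] with x hx
  rw [Real.norm_of_nonneg (pow_nonneg hx.1 L)]
  exact pow_le_one₀ hx.1 hx.2

theorem moment_le_one (L : ℕ) : moment L ≤ 1 := by
  have : moment L ≤ ∫ _, (1 : ℝ) ∂minkowskiMeasure := by
    refine integral_mono_ae (integrable_pow L) (integrable_const _) ?_
    filter_upwards [ae_mem_Icc] with x hx using pow_le_one₀ hx.1 hx.2
  simpa using this

/-- Powers of `x` are at most `1` on the support of the measure, so the `L¹` norms of the terms are
bounded by the summable `c`. -/
theorem hasSum_mul_moment {c : ℕ → ℝ} (hc0 : ∀ n, 0 ≤ c n) (hc : Summable c) (e : ℕ → ℕ) :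
    HasSum (fun n => c n * moment (e n)) (∫ x, ∑' n, c n * x ^ e n ∂minkowskiMeasure) := by
  have h := hasSum_integral_of_summable_integral_norm (μ := minkowskiMeasure)
    (F := fun (n : ℕ) (x : ℝ) => c n * x ^ e n)
    (fun n => (integrable_pow (e n)).const_mul _) ?_
  · simp only [integral_const_mul] at h
    exact h
  · refine hc.of_nonneg_of_le (fun n => integral_nonneg fun _ => norm_nonneg _) fun n => ?_
    have : ∫ x, ‖c n * x ^ e n‖ ∂minkowskiMeasure = c n * moment (e n) := by
      rw [moment, ← integral_const_mul]
      refine integral_congr_ae ?_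
      filter_upwards [ae_mem_Icc] with x hx
      exact Real.norm_of_nonneg (mul_nonneg (hc0 n) (pow_nonneg hx.1 _))
    rw [this]
    exact mul_le_of_le_one_right (hc0 n) (moment_le_one _)

/-! ### Logarithmic integrals against the Minkowski measure -/

theorem integrable_log : Integrable Real.log minkowskiMeasure := by
  refine integrable_inv.mono' Real.measurable_log.aestronglyMeasurable ?_
  filter_upwards [ae_mem_Ioo] with x hx
  rw [Real.norm_of_nonpos (Real.log_nonpos hx.1.le hx.2.le), ← Real.log_inv]
  exact (Real.log_le_sub_one_of_pos (inv_pos.2 hx.1)).trans (by linarith)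

theorem integrable_log_one_add :
    Integrable (fun x => Real.log (1 + x)) minkowskiMeasure := by
  refine Integrable.of_bound (Real.measurable_log.comp (by fun_prop)).aestronglyMeasurable 1 ?_
  filter_upwards [ae_mem_Icc] with x hx
  rw [Real.norm_of_nonneg (Real.log_nonneg (by linarith [hx.1]))]
  exact (Real.log_le_sub_one_of_pos (by linarith [hx.1])).trans (by linarith [hx.2])

/-- Self-similarity applied to `log` reads `∫ log x - 2 ∫ log (1 + x) = 2 ∫ log x`. -/
theorem integral_log :
    ∫ x, Real.log x ∂minkowskiMeasure = -2 * ∫ x, Real.log (1 + x) ∂minkowskiMeasure := by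
  have h := integral_comp_add_integral_comp integrable_log
  have h1 : ∫ x, Real.log (x / (1 + x)) ∂minkowskiMeasure
      = ∫ x, Real.log x ∂minkowskiMeasure - ∫ x, Real.log (1 + x) ∂minkowskiMeasure := by
    rw [← integral_sub integrable_log integrable_log_one_add]
    refine integral_congr_ae ?_
    filter_upwards [ae_mem_Ioo] with x hx
    exact Real.log_div hx.1.ne' (by linarith [hx.1])
  simp only [Real.log_inv, integral_neg] at h
  linarith

theorem hasSum_moment_div :
    HasSum (fun n : ℕ => moment (n + 1) / (((n : ℝ) + 1) * 2 ^ (n + 1)))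
      (Real.log 2 - ∫ x, Real.log (1 + x) ∂minkowskiMeasure) := by
  have hc : Summable (fun n : ℕ => 1 / (((n : ℝ) + 1) * 2 ^ (n + 1))) := by
    refine summable_half.of_nonneg_of_le (fun n => by positivity) fun n => ?_
    rw [one_div_pow]
    refine one_div_le_one_div_of_le (by positivity) ?_
    exact le_mul_of_one_le_left (by positivity) (by simp)
  have h := hasSum_mul_moment (fun n => by positivity) hc (fun n => n + 1)
  convert h using 1
  · ext n
    ring
  -- The series of `-log (1 - x/2)` produces `log (2 - x)`, which is the reflection of `log (1 +
  -- x)`.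
  · rw [← integral_comp_one_sub fun x => Real.log (1 + x)]
    have e : ∀ x ∈ Set.Icc (0 : ℝ) 1, ∑' n : ℕ, 1 / (((n : ℝ) + 1) * 2 ^ (n + 1)) * x ^ (n + 1)
        = Real.log 2 - Real.log (1 + (1 - x)) := by
      intro x hx
      have hlt : |x / 2| < 1 := by
        rw [abs_of_nonneg (by linarith [hx.1])]
        linarith [hx.2]
      have hs := Real.hasSum_pow_div_log_of_abs_lt_one hlt
      rw [show 1 + (1 - x) = 2 * (1 - x / 2) by ring,
        Real.log_mul two_ne_zero (by linarith [hx.2]), ← sub_sub, sub_self, zero_sub, ← hs.tsum_eq]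
      refine tsum_congr fun n => ?_
      rw [div_pow]
      field_simp
    have hi : Integrable (fun x : ℝ => Real.log (1 + (1 - x))) minkowskiMeasure :=
      integrable_comp_one_sub (f := fun x => Real.log (1 + x)) integrable_log_one_add
    rw [integral_congr_ae (ae_mem_Icc.mono e),
      integral_sub (integrable_const _) hi]
    simp

theorem summable_zetaEvenSubOne_div : Summable (fun k : ℕ => zetaEvenSubOne k / ((k : ℝ) + 1)) := by
  have hg : Summable (fun k : ℕ => zetaEvenSubOne 0 * (1 / 4 : ℝ) ^ k) :=
    (summable_geometric_of_lt_one (by norm_num) (by norm_num)).mul_left _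
  refine hg.of_nonneg_of_le (fun k => ?_) fun k => ?_
  · have := zetaEvenSubOne_nonneg k
    positivity
  · exact (div_le_self (zetaEvenSubOne_nonneg k) (by simp)).trans (zetaEvenSubOne_le k)

theorem hasSum_zetaEvenSubOne_mul_moment :
    HasSum (fun k : ℕ => zetaEvenSubOne k * moment (2 * (k + 1)) / ((k : ℝ) + 1))
      ((∫ x, -Real.log (2 * Real.sin (Real.pi * x)) ∂minkowskiMeasure)
        + Real.log 2 + Real.log Real.pi - 3 * ∫ x, Real.log (1 + x) ∂minkowskiMeasure) := by
  have h := hasSum_mul_moment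
    (fun k => div_nonneg (zetaEvenSubOne_nonneg k) (by positivity))
    summable_zetaEvenSubOne_div (fun k => 2 * (k + 1))
  convert h using 1
  · ext k
    ring
  · have hi1 : Integrable (fun x => Real.log (1 - x)) minkowskiMeasure :=
      integrable_comp_one_sub integrable_log
    have hi : Integrable (fun x => -Real.log (2 * Real.sin (Real.pi * x))) minkowskiMeasure := by
      refine integrable_neg_log_one_sub_exp.re.congr ?_
      filter_upwards [ae_mem_Icc] with x hx
      rw [RCLike.re_to_complex, Complex.neg_re, Complex.log_re, norm_one_sub_exp hx.1 hx.2]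
    have e : ∀ x ∈ Set.Ioo (0 : ℝ) 1,
        ∑' k : ℕ, zetaEvenSubOne k / ((k : ℝ) + 1) * x ^ (2 * (k + 1))
          = -Real.log (2 * Real.sin (Real.pi * x)) + (Real.log 2 + Real.log Real.pi)
            + Real.log x + Real.log (1 - x) + Real.log (1 + x) := by
      intro x hx
      rw [tsum_zetaEvenSubOne_mul_pow hx, Real.log_mul two_ne_zero (sin_pi_mul_pos hx).ne']
      ring
    have hi2 : Integrable (fun x => -Real.log (2 * Real.sin (Real.pi * x))
        + (Real.log 2 + Real.log Real.pi)) minkowskiMeasure := hi.add (integrable_const _)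
    have hi3 : Integrable (fun x => -Real.log (2 * Real.sin (Real.pi * x))
        + (Real.log 2 + Real.log Real.pi) + Real.log x) minkowskiMeasure := hi2.add integrable_log
    have hi4 : Integrable (fun x => -Real.log (2 * Real.sin (Real.pi * x))
        + (Real.log 2 + Real.log Real.pi) + Real.log x + Real.log (1 - x)) minkowskiMeasure :=
      hi3.add hi1
    rw [integral_congr_ae (ae_mem_Ioo.mono e), integral_add hi4 integrable_log_one_add,
      integral_add hi3 hi1, integral_add hi2 integrable_log,
      integral_add hi (integrable_const _), integral_comp_one_sub Real.log, integral_log]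
    simp
    ring

end Minkowski

theorem mainTheorem4 :
    Filter.Tendsto (Minkowski.zetaPartialSum 1) Filter.atTop (nhds (Minkowski.zetaM 1)) ∧
    Summable (fun n : ℕ =>
      (riemannZeta (2 * ((n : ℂ) + 1)) - 1) * (Minkowski.moment (2 * (n + 1)) : ℂ)
        / ((n : ℂ) + 1)) ∧
    Summable (fun n : ℕ =>
      (Minkowski.moment (n + 1) : ℂ) / (((n : ℂ) + 1) * 2 ^ (n + 1))) ∧
    (fun n : ℕ =>
      (riemannZeta (2 * ((n : ℂ) + 1)) - 1) * (Minkowski.moment (2 * (n + 1)) : ℂ)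
        / ((n : ℂ) + 1)) =O[Filter.atTop] (fun n : ℕ => ((1 : ℝ) / 4) ^ n) ∧
    (fun n : ℕ =>
      (Minkowski.moment (n + 1) : ℂ) / (((n : ℂ) + 1) * 2 ^ (n + 1)))
        =O[Filter.atTop] (fun n : ℕ => ((1 : ℝ) / 2) ^ n) ∧
    Minkowski.zetaM 1 =
      (∑' n : ℕ, (riemannZeta (2 * ((n : ℂ) + 1)) - 1) * (Minkowski.moment (2 * (n + 1)) : ℂ)
        / ((n : ℂ) + 1))
      - 3 * (∑' n : ℕ, (Minkowski.moment (n + 1) : ℂ) / (((n : ℂ) + 1) * 2 ^ (n + 1)))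
      - (Real.log Real.pi : ℂ) + (Real.log 4 : ℂ) := by
  have hL := Minkowski.tendsto_zetaPartialSum_one
  -- Since `zetaM` is defined by `limUnder`, its value is known only through the convergence `hL`.
  have hM : Minkowski.zetaM 1 = _ := hL.limUnder_eq
  have hA := Minkowski.hasSum_moment_div
  have hS := Minkowski.hasSum_zetaEvenSubOne_mul_moment
  have eS : ∀ n : ℕ, (riemannZeta (2 * ((n : ℂ) + 1)) - 1)
      * (Minkowski.moment (2 * (n + 1)) : ℂ) / ((n : ℂ) + 1)
      = ((Minkowski.zetaEvenSubOne n * Minkowski.moment (2 * (n + 1)) / ((n : ℝ) + 1) : ℝ) : ℂ) := by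
    intro n
    rw [Minkowski.riemannZeta_even_sub_one]
    push_cast
    rfl
  have eA : ∀ n : ℕ, (Minkowski.moment (n + 1) : ℂ) / (((n : ℂ) + 1) * 2 ^ (n + 1))
      = ((Minkowski.moment (n + 1) / (((n : ℝ) + 1) * 2 ^ (n + 1)) : ℝ) : ℂ) := by
    intro n
    push_cast
    rfl
  have hS' := Complex.hasSum_ofReal.2 hS
  have hA' := Complex.hasSum_ofReal.2 hA
  simp only [eS, eA]
  refine ⟨hM ▸ hL, hS'.summable, hA'.summable, ?_, ?_, ?_⟩
  · refine Asymptotics.IsBigO.of_bound (Minkowski.zetaEvenSubOne 0)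
      (Filter.Eventually.of_forall fun n => ?_)
    have h0 := Minkowski.zetaEvenSubOne_nonneg n
    have h1 := Minkowski.moment_nonneg (2 * (n + 1))
    rw [Complex.norm_real, Real.norm_of_nonneg (by positivity), Real.norm_of_nonneg (by positivity)]
    calc _ ≤ Minkowski.zetaEvenSubOne n * Minkowski.moment (2 * (n + 1)) :=
          div_le_self (by positivity) (by simp)
      _ ≤ Minkowski.zetaEvenSubOne n := mul_le_of_le_one_right h0 (Minkowski.moment_le_one _)
      _ ≤ _ := Minkowski.zetaEvenSubOne_le n
  · refine Asymptotics.IsBigO.of_bound 1 (Filter.Eventually.of_forall fun n => ?_)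
    have h1 := Minkowski.moment_nonneg (n + 1)
    rw [Complex.norm_real, Real.norm_of_nonneg (by positivity), Real.norm_of_nonneg (by positivity),
      one_mul, one_div_pow]
    refine div_le_div₀ zero_le_one (Minkowski.moment_le_one _) (by positivity) ?_
    rw [pow_succ]
    have h2 : (0 : ℝ) < 2 ^ n := by positivity
    nlinarith [(Nat.cast_nonneg n : (0 : ℝ) ≤ n)]
  -- The constant `log 4` arises as `3 log 2 - log 2`: the first term from eliminating `∫ log (1 +
  -- x)`, the second from the factor `2` in `2 sin πx`.
  · rw [hM, hS'.tsum_eq, hA'.tsum_eq, show (4 : ℝ) = 2 ^ 2 by norm_num, Real.log_pow]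
    push_cast
    ring
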